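/- Let $F$ be a field, let $q\in F$ satisfy $q^k\neq 1$ for all $k\ge 1$, and let $\mathbf u=(u_1,u_2,\dots)$, $\mathbf v=(v_1,v_2,\dots)$ be sequences in $F$. Write $(a;q)_k=\prod_{i=0}^{k-1}(1-aq^i)$ and $\binom{a}{b}_q=\frac{(q;q)_a}{(q;q)_{a-b}(q;q)_b}$. For non-negative integers $a,b,c,d$ and $x\neq 0$ put $$\mathbb W_{x;(u,v)}(a,b,c,d)=\delta_{a+b=c+d}\;x^{d}\sum_{p=0}^{\min(b,c)}(ux;q)_{c-p}\,(v/x;q)_p\,(v/x)^{b-p}\binom{c+d-p}{c-p}_q\binom{b}{p}_q ;$$ this is the weight of a vertex with bottom, left, top and right edge labels $a,b,c,d$, respectively. For partitions $\mu\subseteq\lambda$ and $n\ge 0$ consider the lattice with $n$ rows, carrying $x_1,\dots,x_n$ from top to bottom, and columns numbered $1,2,3,\dots$ from right to left, column $i$ carrying $(u_i,v_i)$. The edges are labelled by non-negative integers. The bottom edge of column $i$ has label $m_i(\lambda')$ and its top edge has label $m_i(\mu')$, where $m_i(\lambda')$ is the number of columns of length $i$ in the Young diagram of $\lambda$; the left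 boundary labels are $0$ (in each row all but finitely many labels vanish), and the right boundary labels are free. Let $\mathfrak G^{(\mathbf u,\mathbf v)}_{\lambda/\mu}(x_1,\dots,x_n)$ be the partition function of this lattice, i.e. the sum over all labellings of the product over all vertices of the weights $\mathbb W_{x_r;(u_i,v_i)}$ (for non-zero $x_r$ in $F$ or in an extension field of $F$, for instance indeterminates). Then $\mathfrak G^{(\mathbf u,\mathbf v)}_{\lambda/\mu}(x_1,\dots,x_n)$ is given by a polynomial in $x_1,\dots,x_n$ with coefficients in $F$, and this polynomial is invariant under all permutations of the variables $x_1,\dots,x_n$. -/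

import Mathlib

universe w

namespace FusedLattice

noncomputable section

variable {K : Type*} [Field K]

/-- The `q`-Pochhammer symbol `(a; q)_k = (1 - a)(1 - a q) ⋯ (1 - a q^(k-1))`. -/
def qPochhammer (q a : K) (k : ℕ) : K :=
  ∏ i ∈ Finset.range k, (1 - a * q ^ i)

/-- The `q`-binomial coefficient `(q;q)_a / ((q;q)_(a-b) (q;q)_b)`; it is only used for `b ≤ a`
and for `q` with `q ^ k ≠ 1` for all `k ≥ 1`, so that the denominator does not vanish. -/
def qBinomial (q : K) (a b : ℕ) : K :=
  qPochhammer q q a / (qPochhammer q q (a - b) * qPochhammer q q b)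

/-- The weight `𝕎_{x;(u,v)}(a,b,c,d)` of a vertex with bottom label `a`, left label `b`,
top label `c` and right label `d`. The sum is over `0 ≤ p ≤ min b c`, and `(x / v) ^ (p - b)` is
written `(v / x) ^ (b - p)`, so that `v = 0` is allowed. -/
def weight (q x u v : K) (a b c d : ℕ) : K :=
  if a + b = c + d then
    x ^ d * ∑ p ∈ Finset.range (min b c + 1),
      qPochhammer q (u * x) (c - p) * qPochhammer q (v / x) p * (v / x) ^ (b - p) *
        qBinomial q (c + d - p) (c - p) * qBinomial q b p
  else 0

/-- Basis states of `𝕍(∞)`: finitely supported sequences of labels of the vertical edges.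
The columns of the lattice are numbered from right to left, starting at the right end;
index `j : ℕ` stands for the `(j+1)`-st column. -/
abbrev State : Type := ℕ →₀ ℕ

/-- Partition function of a single row with spectral parameter `x`, bottom labels `i` and top
labels `k`. The `(j+1)`-st column has parameters `(u j, v j)`. A configuration is a labelling `h`
of the horizontal edges: `h j` is the label of the edge to the right of the `(j+1)`-st column,
hence `h (j + 1)` is the label of the edge to its left. The left boundary label is `0` (`h` is
finitely supported) and the right boundary label `h 0` is free. -/
def rowWeight (q : K) (u v : ℕ → K) (x : K) (i k : State) : K :=
  ∑ᶠ h : ℕ →₀ ℕ, ∏ᶠ j : ℕ, weight q x (u j) (v j) (i j) (h (j + 1)) (k j) (h j)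

/-- The row-to-row transfer matrix `𝕋(x) ∈ End 𝕍(∞)`, sending the bottom state `i` to
`∑_k rowWeight(i, k) • k`, the sum being over all top states `k`. -/
def transfer (q : K) (u v : ℕ → K) (x : K) : Module.End K (State →₀ K) :=
  Finsupp.linearCombination K fun i : State =>
    ∑ᶠ k : State, Finsupp.single k (rowWeight q u v x i k)

/-- The state attached to (the conjugate of) a partition: the `(j+1)`-st column of the lattice is
labelled by the number of columns of size `j + 1` in the Young diagram. -/
def columnState (lam : YoungDiagram) : State :=
  (Multiset.toFinsupp (lam.transpose.rowLens : Multiset ℕ)).comapDomain Nat.succ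
    (Nat.succ_injective.injOn)

/-- The skew function `𝔊^{(u,v)}_{lam/mu}(x_1, …, x_n)` at a point `x`: the partition function of
the lattice with `n` rows with spectral parameters `x_1, …, x_n` from top to bottom, bottom state
given by the columns of `lam` and top state given by the columns of `mu`. -/
def skewG (q : K) (u v : ℕ → K) (lam mu : YoungDiagram) {n : ℕ} (x : Fin n → K) : K :=
  ((List.ofFn fun r : Fin n => transfer q u v (x r)).prod
    (Finsupp.single (columnState lam) 1)) (columnState mu)

end

end FusedLattice

/-! Symmetry follows from commuting transfer matrices, hence from a Yang–Baxter equation. A vertex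
is read as a functional on functions of its outgoing labels and factors into two halves. In
`exchange`, some left particles go straight up and the others join the bottom ones. In `splitOp`,
the joined particles go up or right.

`yang_baxter` is proved by two reductions. A particle added on the left acts on test functions
through `u` and `v = t * x` only (`vertexOp_succ_left`), so `b₂` drops to `0`. A particle removed on
the right is traced back to the bottom or left edge (`vertexOp_lower_right`), so `d₁` drops to `0`.
The remaining case is tested on the functions `hpoch q u Y d`, which suffice by linearity. There it
becomes a `q`-Saalschütz summation (`saalschutz`) and the symmetry of a terminating sum
(`symSum_comm`).

In two full rows the exchange matrix is trivial at the empty left boundary. At the free right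
boundary it disappears because its weights sum to one (`exchange_one`). For polynomiality, the
powers of `x` that clear denominators telescope along a row whose left label is `0`. Symmetry of the
polynomial is then read off at the generic point. -/

namespace FusedLattice

noncomputable section

open Finset

/-! ### Division-free `q`-Pochhammer and Gaussian binomial calculus. -/

section Ring

variable {R : Type*} [CommRing R]

/-- The `q`-Pochhammer symbol `(a; q)_k` over a commutative ring. -/
def poch (q a : R) (k : ℕ) : R := ∏ i ∈ range k, (1 - a * q ^ i)

/-- The homogeneous `q`-Pochhammer symbol `(u - Y) (u - Y q) ⋯ (u - Y q^(d-1))`. -/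
def hpoch (q u Y : R) (d : ℕ) : R := ∏ i ∈ range d, (u - Y * q ^ i)

/-- The Gaussian binomial coefficient `binom(i + j, i)_q`. -/
def gauss (q : R) : ℕ → ℕ → R
  | 0, _ => 1
  | _ + 1, 0 => 1
  | i + 1, j + 1 => gauss q i (j + 1) + q ^ (i + 1) * gauss q (i + 1) j

@[simp] lemma poch_zero (q a : R) : poch q a 0 = 1 := by simp [poch]

lemma poch_succ (q a : R) (k : ℕ) : poch q a (k + 1) = poch q a k * (1 - a * q ^ k) := by
  simp [poch, prod_range_succ]

lemma poch_succ' (q a : R) (k : ℕ) : poch q a (k + 1) = (1 - a) * poch q (q * a) k := by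
  simp only [poch, prod_range_succ']
  rw [mul_comm]
  congr 1
  · simp
  · exact prod_congr rfl fun i _ => by ring

lemma poch_add (q a : R) (m n : ℕ) :
    poch q a (m + n) = poch q a m * poch q (a * q ^ m) n := by
  simp only [poch, prod_range_add]
  congr 1
  exact prod_congr rfl fun i _ => by ring

@[simp] lemma hpoch_zero (q u Y : R) : hpoch q u Y 0 = 1 := by simp [hpoch]

lemma hpoch_succ (q u Y : R) (k : ℕ) :
    hpoch q u Y (k + 1) = hpoch q u Y k * (u - Y * q ^ k) := by
  simp [hpoch, prod_range_succ]

lemma hpoch_add (q u Y : R) (m n : ℕ) :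
    hpoch q u Y (m + n) = hpoch q u Y m * hpoch q u (Y * q ^ m) n := by
  simp only [hpoch, prod_range_add]
  congr 1
  exact prod_congr rfl fun i _ => by ring

@[simp] lemma gauss_zero_left (q : R) (j : ℕ) : gauss q 0 j = 1 := by simp [gauss]

@[simp] lemma gauss_zero_right (q : R) (i : ℕ) : gauss q i 0 = 1 := by cases i <;> simp [gauss]

lemma gauss_succ_succ (q : R) (i j : ℕ) :
    gauss q (i + 1) (j + 1) = gauss q i (j + 1) + q ^ (i + 1) * gauss q (i + 1) j := by
  rw [gauss]

/-- The two absorption rules are proved jointly: the inductive step for either one uses both at a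
smaller index. -/
lemma one_sub_mul_gauss_succ (q : R) : ∀ i j : ℕ,
    (1 - q ^ (i + 1)) * gauss q (i + 1) j = (1 - q ^ (i + j + 1)) * gauss q i j ∧
      (1 - q ^ (j + 1)) * gauss q i (j + 1) = (1 - q ^ (i + j + 1)) * gauss q i j
  | 0, 0 => by simp
  | 0, j + 1 => by
    have h := (one_sub_mul_gauss_succ q 0 j).1
    simp only [gauss_zero_left, gauss_succ_succ] at h ⊢
    refine ⟨?_, by simp⟩
    simp only [zero_add] at h ⊢
    linear_combination q * h
  | i + 1, 0 => by
    have h := (one_sub_mul_gauss_succ q i 0).2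
    simp only [gauss_zero_right, gauss_succ_succ] at h ⊢
    refine ⟨by simp, ?_⟩
    simp only [zero_add] at h ⊢
    linear_combination h
  | i + 1, j + 1 => by
    have h1 := one_sub_mul_gauss_succ q i (j + 1)
    have h2 := one_sub_mul_gauss_succ q (i + 1) j
    have e : gauss q (i + 1) (j + 1) = gauss q i (j + 1) + q ^ (i + 1) * gauss q (i + 1) j :=
      gauss_succ_succ q i j
    have e1 : gauss q (i + 1 + 1) (j + 1) =
        gauss q (i + 1) (j + 1) + q ^ (i + 1 + 1) * gauss q (i + 1 + 1) j := gauss_succ_succ q _ j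
    have e2 : gauss q (i + 1) (j + 1 + 1) =
        gauss q i (j + 1 + 1) + q ^ (i + 1) * gauss q (i + 1) (j + 1) := gauss_succ_succ q i _
    constructor
    · rw [e1]
      linear_combination q ^ (i + 2) * h2.1 - q ^ (i + 2) * h2.2
    · rw [e2]
      linear_combination h1.2 - h1.1

lemma gauss_succ_succ' (q : R) : ∀ i j : ℕ,
    gauss q (i + 1) (j + 1) = gauss q (i + 1) j + q ^ (j + 1) * gauss q i (j + 1) := by
  intro i j
  have h := one_sub_mul_gauss_succ q i (j + 1)
  have h2 := one_sub_mul_gauss_succ q (i + 1) j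
  have h3 := one_sub_mul_gauss_succ q i j
  rw [gauss_succ_succ]
  linear_combination h3.2 - h3.1

/-- Summation against Gaussian binomial coefficients. -/
def gsum (q : R) (n : ℕ) (F : ℕ → ℕ → R) : R :=
  ∑ p ∈ antidiagonal n, gauss q p.1 p.2 * F p.1 p.2

@[simp] lemma gsum_zero (q : R) (F : ℕ → ℕ → R) : gsum q 0 F = F 0 0 := by simp [gsum]

lemma gsum_congr {q : R} {n : ℕ} {F G : ℕ → ℕ → R}
    (h : ∀ i j, i + j = n → F i j = G i j) : gsum q n F = gsum q n G :=
  sum_congr rfl fun p hp => by rw [h _ _ (mem_antidiagonal.1 hp)]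

lemma gsum_add (q : R) (n : ℕ) (F G : ℕ → ℕ → R) :
    gsum q n (fun i j => F i j + G i j) = gsum q n F + gsum q n G := by
  simp [gsum, mul_add, sum_add_distrib]

lemma gsum_sub (q : R) (n : ℕ) (F G : ℕ → ℕ → R) :
    gsum q n (fun i j => F i j - G i j) = gsum q n F - gsum q n G := by
  simp [gsum, mul_sub, sum_sub_distrib]

lemma gsum_mul_left (q : R) (n : ℕ) (r : R) (F : ℕ → ℕ → R) :
    gsum q n (fun i j => r * F i j) = r * gsum q n F := by
  simp [gsum, mul_sum, mul_left_comm]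

/-- The coefficients are left general because `saalschutz` needs a Pascal rule for Gaussian
binomials multiplied by a Pochhammer symbol. -/
lemma gsum_succ_aux (n : ℕ) (c A B : ℕ → ℕ → R) (F : ℕ → ℕ → R)
    (h0 : c 0 (n + 1) = B 0 n) (h1 : c (n + 1) 0 = A n 0)
    (h : ∀ i j, c (i + 1) (j + 1) = A i (j + 1) + B (i + 1) j) :
    ∑ p ∈ antidiagonal (n + 1), c p.1 p.2 * F p.1 p.2 =
      ∑ p ∈ antidiagonal n, (A p.1 p.2 * F (p.1 + 1) p.2 + B p.1 p.2 * F p.1 (p.2 + 1)) := by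
  rw [sum_add_distrib, Nat.sum_antidiagonal_succ]
  cases n with
  | zero => simp [h0, h1]; ring
  | succ n =>
    rw [Nat.sum_antidiagonal_succ', Nat.sum_antidiagonal_succ'
      (f := fun p : ℕ × ℕ => A p.1 p.2 * F (p.1 + 1) p.2), Nat.sum_antidiagonal_succ
      (f := fun p : ℕ × ℕ => B p.1 p.2 * F p.1 (p.2 + 1))]
    simp only [h, h0, h1, add_mul, sum_add_distrib]
    ring

/-- The first `q`-Pascal rule, for sums. -/
lemma gsum_succ (q : R) (n : ℕ) (F : ℕ → ℕ → R) :
    gsum q (n + 1) F = gsum q n fun i j => F (i + 1) j + q ^ i * F i (j + 1) := by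
  unfold gsum
  rw [gsum_succ_aux n (gauss q) (gauss q) (fun i j => q ^ i * gauss q i j) F (by simp) (by simp)
    (gauss_succ_succ q)]
  exact sum_congr rfl fun p _ => by ring

/-- The second `q`-Pascal rule, for sums. -/
lemma gsum_succ' (q : R) (n : ℕ) (F : ℕ → ℕ → R) :
    gsum q (n + 1) F = gsum q n fun i j => q ^ j * F (i + 1) j + F i (j + 1) := by
  unfold gsum
  rw [gsum_succ_aux n (gauss q) (fun i j => q ^ j * gauss q i j) (gauss q) F (by simp) (by simp)
    (fun i j => by rw [gauss_succ_succ', add_comm])]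
  exact sum_congr rfl fun p _ => by ring

lemma gsum_one_sub_fst (q : R) (n : ℕ) (F : ℕ → ℕ → R) :
    gsum q (n + 1) (fun i j => (1 - q ^ i) * F i j) =
      (1 - q ^ (n + 1)) * gsum q n fun i j => F (i + 1) j := by
  unfold gsum
  rw [Nat.sum_antidiagonal_succ, mul_sum]
  simp only [pow_zero, sub_self, zero_mul, mul_zero, zero_add]
  refine sum_congr rfl fun p hp => ?_
  have h := (one_sub_mul_gauss_succ q p.1 p.2).1
  rw [mem_antidiagonal.1 hp] at h
  linear_combination F (p.1 + 1) p.2 * h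

lemma gsum_one_sub_snd (q : R) (n : ℕ) (F : ℕ → ℕ → R) :
    gsum q (n + 1) (fun i j => (1 - q ^ j) * F i j) =
      (1 - q ^ (n + 1)) * gsum q n fun i j => F i (j + 1) := by
  unfold gsum
  rw [Nat.sum_antidiagonal_succ', mul_sum]
  simp only [pow_zero, sub_self, zero_mul, mul_zero, zero_add]
  refine sum_congr rfl fun p hp => ?_
  have h := (one_sub_mul_gauss_succ q p.1 p.2).2
  rw [mem_antidiagonal.1 hp] at h
  linear_combination F p.1 (p.2 + 1) * h

/-! ### The two halves of a vertex, and adding or removing one particle. -/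

/-- The `R`-matrix: `l` of `n` particles stay, `m` of them change the row. -/
def exchange (q s : R) (n : ℕ) (F : ℕ → ℕ → R) : R :=
  gsum q n fun m l => poch q s m * s ^ l * F m l

/-- The second half of a vertex: out of `n` particles, `m` go up and `d` go right. -/
def splitOp (q x u : R) (n : ℕ) (F : ℕ → ℕ → R) : R :=
  gsum q n fun m d => poch q (u * x) m * x ^ d * F m d

/-- The vertex with bottom label `a` and left label `b`, as a functional on functions of the top
and right labels; `t` stands for `v / x`. -/
def vertexOp (q x u t : R) (a b : ℕ) (F : ℕ → ℕ → R) : R :=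
  exchange q t b fun p l => splitOp q x u (a + l) fun m d => F (p + m) d

lemma exchange_congr {q s : R} {n : ℕ} {F G : ℕ → ℕ → R}
    (h : ∀ i j, i + j = n → F i j = G i j) : exchange q s n F = exchange q s n G :=
  gsum_congr fun i j hij => by rw [h i j hij]

lemma exchange_add (q s : R) (n : ℕ) (F G : ℕ → ℕ → R) :
    exchange q s n (fun i j => F i j + G i j) = exchange q s n F + exchange q s n G := by
  simp [exchange, mul_add, gsum_add]

lemma exchange_mul_left (q s : R) (n : ℕ) (r : R) (F : ℕ → ℕ → R) :
    exchange q s n (fun i j => r * F i j) = r * exchange q s n F := by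
  rw [exchange, exchange, ← gsum_mul_left]
  exact gsum_congr fun i j _ => by ring

lemma splitOp_congr {q x u : R} {n : ℕ} {F G : ℕ → ℕ → R}
    (h : ∀ i j, i + j = n → F i j = G i j) : splitOp q x u n F = splitOp q x u n G :=
  gsum_congr fun i j hij => by rw [h i j hij]

lemma splitOp_add (q x u : R) (n : ℕ) (F G : ℕ → ℕ → R) :
    splitOp q x u n (fun i j => F i j + G i j) = splitOp q x u n F + splitOp q x u n G := by
  simp [splitOp, mul_add, gsum_add]

lemma splitOp_mul_left (q x u : R) (n : ℕ) (r : R) (F : ℕ → ℕ → R) :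
    splitOp q x u n (fun i j => r * F i j) = r * splitOp q x u n F := by
  rw [splitOp, splitOp, ← gsum_mul_left]
  exact gsum_congr fun i j _ => by ring

lemma vertexOp_congr {q x u t : R} {a b : ℕ} {F G : ℕ → ℕ → R}
    (h : ∀ c d, c + d = a + b → F c d = G c d) : vertexOp q x u t a b F = vertexOp q x u t a b G :=
  exchange_congr fun p l hpl => splitOp_congr fun m d hmd => h _ _ (by omega)

lemma vertexOp_add (q x u t : R) (a b : ℕ) (F G : ℕ → ℕ → R) :
    vertexOp q x u t a b (fun i j => F i j + G i j) =
      vertexOp q x u t a b F + vertexOp q x u t a b G := by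
  simp only [vertexOp, splitOp_add, exchange_add]

lemma vertexOp_mul_left (q x u t : R) (a b : ℕ) (r : R) (F : ℕ → ℕ → R) :
    vertexOp q x u t a b (fun i j => r * F i j) = r * vertexOp q x u t a b F := by
  simp only [vertexOp, splitOp_mul_left, exchange_mul_left]

lemma exchange_succ (q s : R) (n : ℕ) (F : ℕ → ℕ → R) :
    exchange q s (n + 1) F =
      exchange q s n fun m l => (1 - s * q ^ m) * F (m + 1) l + s * q ^ m * F m (l + 1) := by
  rw [exchange, gsum_succ]
  exact gsum_congr fun m l _ => by rw [poch_succ]; ring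

lemma splitOp_succ (q x u : R) (n : ℕ) (F : ℕ → ℕ → R) :
    splitOp q x u (n + 1) F =
      splitOp q x u n fun m d => (1 - u * x * q ^ m) * F (m + 1) d + q ^ m * x * F m (d + 1) := by
  rw [splitOp, gsum_succ]
  exact gsum_congr fun m l _ => by rw [poch_succ]; ring

/-- The two weights `1 - s * q ^ m` and `s * q ^ m` of an added particle sum to one. This is what
removes the exchange matrix at the free right boundary. -/
lemma exchange_one (q s : R) (n : ℕ) : exchange q s n (fun _ _ => 1) = 1 := by
  induction n with
  | zero => simp [exchange]
  | succ n ih =>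
    rw [exchange_succ, exchange_congr (G := fun _ _ => 1) fun _ _ _ => by ring, ih]

@[simp] lemma exchange_zero (q s : R) (F : ℕ → ℕ → R) : exchange q s 0 F = F 0 0 := by
  simp [exchange]

lemma vertexOp_zero_right (q x u t : R) (a : ℕ) (F : ℕ → ℕ → R) :
    vertexOp q x u t a 0 F = splitOp q x u a F := by
  simp [vertexOp]

/-- Adding a particle to the left edge of a vertex. -/
lemma vertexOp_succ_left (q x u t : R) (a b : ℕ) (F : ℕ → ℕ → R) :
    vertexOp q x u t a (b + 1) F = vertexOp q x u t a b fun c d =>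
      (1 - u * (t * x) * q ^ c) * F (c + 1) d + t * x * q ^ c * F c (d + 1) := by
  unfold vertexOp
  rw [exchange_succ]
  refine exchange_congr fun p l _ => ?_
  rw [← add_assoc, splitOp_succ, ← splitOp_mul_left, ← splitOp_mul_left, ← splitOp_add]
  refine splitOp_congr fun m d _ => ?_
  -- The terms `t * q ^ p` cancel, so only `c = p + m` and the product `t * x` survive.
  rw [show p + 1 + m = p + m + 1 by ring, show p + (m + 1) = p + m + 1 by ring]
  ring

/-- Absorption in `l`. The truncated `l - 1` and `n - 1` are harmless, since `1 - q ^ l` and `1 - q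
^ n` vanish at `0`. -/
lemma exchange_lower (q s : R) (n : ℕ) (F : ℕ → ℕ → R) :
    exchange q s n (fun m l => (1 - q ^ l) * F m (l - 1)) =
      s * (1 - q ^ n) * exchange q s (n - 1) F := by
  cases n with
  | zero => simp
  | succ n =>
    have h := gsum_one_sub_snd q n fun m l => poch q s m * s ^ l * F m (l - 1)
    rw [exchange, exchange, Nat.add_sub_cancel,
      gsum_congr (G := fun m l => (1 - q ^ l) * (poch q s m * s ^ l * F m (l - 1)))
      fun m d _ => by ring, h, ← gsum_mul_left, ← gsum_mul_left]
    refine gsum_congr fun m l _ => ?_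
    simp only [Nat.add_sub_cancel]
    ring

lemma exchange_no_stay (q s : R) (n : ℕ) (G : ℕ → R) :
    exchange q s n (fun m l => if l = 0 then G m else 0) = poch q s n * G n := by
  rw [exchange, gsum, Finset.sum_eq_single (n, 0)]
  · simp
  · rintro ⟨m, d⟩ h hne
    have : d ≠ 0 := by
      rintro rfl
      simp at h
      simp [h] at hne
    simp [this]
  · simp

/-- Removing a particle from the right edge of a vertex. -/
lemma vertexOp_lower_right (q x u t : R) (a b : ℕ) (F : ℕ → ℕ → R) :
    vertexOp q x u t a b (fun c d => (1 - q ^ d) * F c (d - 1)) =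
      x * (1 - q ^ a) * vertexOp q x u t (a - 1) b F +
        t * x * q ^ a * (1 - q ^ b) * vertexOp q x u t a (b - 1) F := by
  have key : ∀ n p, splitOp q x u n (fun m d => (1 - q ^ d) * F (p + m) (d - 1)) =
      x * (1 - q ^ n) * splitOp q x u (n - 1) fun m d => F (p + m) d := by
    intro n p
    cases n with
    | zero => simp [splitOp]
    | succ n =>
      have h := gsum_one_sub_snd q n fun m d => poch q (u * x) m * x ^ d * F (p + m) (d - 1)
      rw [splitOp, splitOp, Nat.add_sub_cancel]
      rw [gsum_congr (G := fun m d => (1 - q ^ d) * (poch q (u * x) m * x ^ d * F (p + m) (d - 1)))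
        fun m d _ => by ring, h, ← gsum_mul_left, ← gsum_mul_left]
      refine gsum_congr fun m d _ => ?_
      simp only [Nat.add_sub_cancel]
      ring
  unfold vertexOp
  simp only [key]
  -- Writing `1 - q ^ (a + l) = (1 - q ^ a) + q ^ a * (1 - q ^ l)` separates a particle that came
  -- from the bottom from one that came from the left.
  have e1 : ∀ p l, x * (1 - q ^ (a + l)) * splitOp q x u (a + l - 1) (fun m d => F (p + m) d) =
      x * (1 - q ^ a) * splitOp q x u (a - 1 + l) (fun m d => F (p + m) d) +
      q ^ a * x * ((1 - q ^ l) * splitOp q x u (a + (l - 1)) fun m d => F (p + m) d) := by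
    intro p l
    rcases a with _ | a
    · simp; ring
    · rcases l with _ | l
      · simp
      · rw [show a + 1 + (l + 1) - 1 = a + 1 + l by omega,
          show a + 1 - 1 + (l + 1) = a + 1 + l by omega, Nat.add_sub_cancel]
        ring
  simp only [e1, exchange_add, exchange_mul_left]
  rw [exchange_lower q t b fun p l => splitOp q x u (a + l) fun m d => F (p + m) d]
  ring

/-- For this test function a new particle contributes `1 - x * Y * q ^ (m + d)`, which is constant
on the antidiagonal; hence a product formula. The same cancellation gives `vertexOp_hpoch`. -/
lemma splitOp_hpoch (q x u Y : R) (a : ℕ) :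
    splitOp q x u a (fun _ d => hpoch q u Y d) = poch q (x * Y) a := by
  induction a with
  | zero => simp [splitOp]
  | succ a ih =>
    rw [splitOp_succ, poch_succ, ← ih, mul_comm (splitOp q x u a _), ← splitOp_mul_left]
    refine splitOp_congr fun m d h => ?_
    rw [hpoch_succ, ← h, pow_add]
    ring

lemma vertexOp_hpoch (q x u t Y : R) (a b : ℕ) :
    vertexOp q x u t a b (fun _ d => hpoch q u Y d) =
      poch q (x * Y) a * poch q (t * x * Y * q ^ a) b := by
  induction b with
  | zero => rw [vertexOp_zero_right, splitOp_hpoch]; simp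
  | succ b ih =>
    rw [vertexOp_succ_left, poch_succ, ← mul_assoc (poch q (x * Y) a), ← ih, mul_comm (vertexOp q x u t a b _),
      ← vertexOp_mul_left]
    refine vertexOp_congr fun c d h => ?_
    rw [hpoch_succ, mul_assoc _ (q ^ a), ← pow_add, ← h, pow_add]
    ring

lemma vertexOp_no_exit (q x u t : R) (a b : ℕ) (G : ℕ → R) :
    vertexOp q x u t a b (fun c d => if d = 0 then G c else 0) =
      poch q (u * x) a * poch q (u * (t * x) * q ^ a) b * G (a + b) := by
  induction b generalizing G with
  | zero =>
    have h := exchange_no_stay q (u * x) a G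
    rw [vertexOp_zero_right, splitOp, poch_zero, mul_one, add_zero, ← h, exchange]
    refine gsum_congr fun m d _ => ?_
    by_cases hd : d = 0 <;> simp [hd]
  | succ b ih =>
    rw [vertexOp_succ_left]
    have := ih fun c => (1 - u * (t * x) * q ^ c) * G (c + 1)
    rw [vertexOp_congr (G := fun c d => if d = 0 then (1 - u * (t * x) * q ^ c) * G (c + 1) else 0),
      this, poch_succ, pow_add, add_assoc]
    · ring
    · intro c d _
      by_cases hd : d = 0 <;> simp [hd]

/-! ### Hypergeometric identities behind the base case. -/

/-- A form of the `q`-Pfaff–Saalschütz summation. -/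
lemma saalschutz (q x u s Y : R) (N : ℕ) :
    splitOp q x u N (fun m d => poch q s d * hpoch q u Y d * poch q (s * x * Y * q ^ d) m) =
      poch q (u * (s * x)) N * poch q (x * Y) N := by
  induction N generalizing s with
  | zero => simp [splitOp]
  | succ N ih =>
    have h := ih (q * s)
    have e : poch q (u * (s * x)) (N + 1) * poch q (x * Y) (N + 1) =
        (1 - u * (s * x)) * (1 - x * Y * q ^ N) *
          (poch q (u * (q * s * x)) N * poch q (x * Y) N) := by
      rw [poch_succ', poch_succ, show q * (u * (s * x)) = u * (q * s * x) by ring]; ring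
    rw [e, ← h, ← splitOp_mul_left, splitOp, splitOp, gsum, gsum]
    -- This Pascal rule is the first rule minus `s` times the second; it shifts `s` to `q * s`.
    have key := gsum_succ_aux N (fun m d => gauss q m d * poch q s d)
      (fun m d => gauss q m d * poch q (q * s) d)
      (fun m d => gauss q m d * ((q ^ m - s) * poch q (q * s) d))
      (fun m d => poch q (u * x) m * x ^ d * hpoch q u Y d * poch q (s * x * Y * q ^ d) m)
      (by simp [poch_succ']) (by simp) (fun m d => by
        have h1 := gauss_succ_succ q m d
        have h2 := gauss_succ_succ' q m d
        rw [poch_succ', poch_succ]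
        linear_combination poch q (q * s) d * (h1 - s * h2))
    refine (sum_congr rfl fun p _ => by ring).trans (key.trans (sum_congr rfl fun p hp => ?_))
    rw [← mem_antidiagonal.1 hp, poch_succ, poch_succ' q (s * x * Y * q ^ p.2), hpoch_succ,
      show q * (s * x * Y * q ^ p.2) = s * x * Y * q ^ (p.2 + 1) by ring,
      show q * s * x * Y * q ^ p.2 = s * x * Y * q ^ (p.2 + 1) by ring]
    ring

/-- A terminating basic hypergeometric sum, symmetric in `s` and `t`. -/
def symSum (q U Z s t : R) (b : ℕ) : R :=
  exchange q s b fun m l => poch q (U * t) l * poch q Z l * poch q (t * Z * q ^ l) m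

/-- The second Pascal rule: the first term has one more staying particle, the second one more
exchanged particle. -/
lemma symSum_succ (q U Z s t : R) (b : ℕ) :
    symSum q U Z s t (b + 1) = s * (1 - U * t) * (1 - Z) * symSum q (q * U) (q * Z) s t b +
      (1 - s) * (1 - t * Z * q ^ b) * symSum q U Z (q * s) t b := by
  unfold symSum exchange
  rw [gsum_succ', gsum_add, add_comm, ← gsum_mul_left, ← gsum_mul_left]
  congr 1
  · refine gsum_congr fun m l _ => ?_
    dsimp only
    rw [poch_succ' q (U * t), poch_succ' q Z, show q * (U * t) = q * U * t by ring,
      show t * Z * q ^ (l + 1) = t * (q * Z) * q ^ l by ring]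
    ring
  · refine gsum_congr fun m l h => ?_
    dsimp only
    rw [poch_succ' q s, poch_succ, ← h, mul_pow, pow_add]
    ring

/-- This is precisely the defect in symmetry of the recursion `symSum_succ`. Absorption on both
sides realigns the indices (`shift`), after which the summand vanishes term by term. -/
lemma symSum_contiguous (q U Z s t : R) (b : ℕ) :
    (s - t) * (1 - Z) * symSum q (q * U) (q * Z) s t b +
      (1 - s) * (1 - t * Z * q ^ b) * symSum q U Z (q * s) t b -
      (1 - t) * (1 - s * Z * q ^ b) * symSum q U Z s (q * t) b = 0 := by
  have shift : gsum q b (fun m l => (1 - q ^ m) * (poch q s m * s ^ (l + 1) *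
      poch q (q * U * t) l * poch q Z (l + 1) * poch q (t * Z * q ^ (l + 1)) m)) =
      gsum q b (fun m l => (1 - q ^ l) * (poch q s (m + 1) * s ^ l *
      poch q (q * U * t) (l - 1) * poch q Z l * poch q (t * Z * q ^ l) (m + 1))) := by
    cases b with
    | zero => simp
    | succ b =>
      rw [gsum_one_sub_fst q b fun m l => poch q s m * s ^ (l + 1) *
        poch q (q * U * t) l * poch q Z (l + 1) * poch q (t * Z * q ^ (l + 1)) m,
        gsum_one_sub_snd q b fun m l => poch q s (m + 1) * s ^ l *
        poch q (q * U * t) (l - 1) * poch q Z l * poch q (t * Z * q ^ l) (m + 1)]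
      simp only [Nat.add_sub_cancel]
  have split : (s - t) * (1 - Z) * symSum q (q * U) (q * Z) s t b -
      (1 - t) * (1 - s * Z * q ^ b) * symSum q U Z s (q * t) b =
      gsum q b (fun m l => (1 - q ^ m) * (poch q s m * s ^ (l + 1) *
      poch q (q * U * t) l * poch q Z (l + 1) * poch q (t * Z * q ^ (l + 1)) m)) -
      gsum q b (fun m l => poch q s (m + 1) * s ^ l *
      poch q (q * U * t) l * poch q Z l * poch q (t * Z * q ^ l) (m + 1)) := by
    unfold symSum exchange
    rw [← gsum_mul_left, ← gsum_mul_left, ← gsum_sub, ← gsum_sub]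
    refine gsum_congr fun m l h => ?_
    have hZ : (1 - Z) * poch q (q * Z) l = poch q Z l * (1 - Z * q ^ l) := by
      rw [← poch_succ', poch_succ]
    dsimp only
    rw [poch_succ q s, poch_succ q Z, poch_succ' q (t * Z * q ^ l), ← h, pow_add,
      show U * (q * t) = q * U * t by ring, show t * (q * Z) * q ^ l = t * Z * q ^ (l + 1) by ring,
      show q * t * Z * q ^ l = t * Z * q ^ (l + 1) by ring,
      show q * (t * Z * q ^ l) = t * Z * q ^ (l + 1) by ring]
    linear_combination (s - t) * poch q s m * s ^ l * poch q (q * U * t) l *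
      poch q (t * Z * q ^ (l + 1)) m * hZ
  have third : (1 - s) * (1 - t * Z * q ^ b) * symSum q U Z (q * s) t b =
      gsum q b (fun m l => poch q s (m + 1) * s ^ l * q ^ l *
      poch q (U * t) l * poch q Z l * poch q (t * Z * q ^ l) (m + 1)) := by
    unfold symSum exchange
    rw [← gsum_mul_left]
    refine gsum_congr fun m l h => ?_
    rw [poch_succ', poch_succ, ← h, mul_pow, pow_add]
    ring
  rw [add_sub_right_comm, split, shift, third, ← gsum_sub, ← gsum_add,
    gsum_congr (G := fun _ _ => 0 * 0), gsum_mul_left, zero_mul]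
  intro m l _
  rcases l with _ | l
  · simp
  · rw [poch_succ q (q * U * t), poch_succ' q (U * t), show q * (U * t) = q * U * t by ring,
      Nat.add_sub_cancel]
    ring

/-- The induction hypothesis, applied at shifted parameters, turns the difference of the two
recursions into the contiguous relation. -/
lemma symSum_comm (q U Z s t : R) (b : ℕ) : symSum q U Z s t b = symSum q U Z t s b := by
  induction b generalizing U Z s t with
  | zero => simp [symSum]
  | succ b ih =>
    rw [symSum_succ, symSum_succ, ih (q * U) (q * Z) t s, ih U Z (q * t) s]
    linear_combination symSum_contiguous q U Z s t b

/-- The Yang–Baxter equation with `b₂ = 0` and `d₁ = 0`, on a family of test functions. -/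
lemma base_hpoch (q x u s t Y : R) (a b : ℕ) :
    poch q (u * (s * x)) a * exchange q s b (fun m l => poch q (u * (t * x) * q ^ a) l *
        vertexOp q x u t (a + l) m fun _ d => hpoch q u Y d) =
      vertexOp q x u t a b fun k d => splitOp q (s * x) u k fun _ e =>
        poch q s d * hpoch q u Y (e + d) := by
  have rhs : ∀ k d, splitOp q (s * x) u k (fun _ e => poch q s d * hpoch q u Y (e + d)) =
      poch q s d * hpoch q u Y d * poch q (s * x * Y * q ^ d) k := by
    intro k d
    rw [show s * x * Y * q ^ d = s * x * (Y * q ^ d) by ring, ← splitOp_hpoch q (s * x) u,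
      ← splitOp_mul_left]
    refine splitOp_congr fun _ e _ => ?_
    rw [add_comm, hpoch_add, mul_assoc]
  simp only [rhs, vertexOp_hpoch]
  -- Once the last Pochhammer symbol is split at `m`, its second factor depends only on `m + d = a +
  -- l`, and `saalschutz` sums the rest.
  have inner : ∀ p l, splitOp q x u (a + l) (fun m d =>
      poch q s d * hpoch q u Y d * poch q (s * x * Y * q ^ d) (p + m)) =
      poch q (u * (s * x)) a * poch q (x * Y) a *
        (poch q (u * x * q ^ a * s) l * poch q (x * Y * q ^ a) l *
          poch q (s * (x * Y * q ^ a) * q ^ l) p) := by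
    intro p l
    have h := saalschutz q x u s Y (a + l)
    rw [poch_add, poch_add] at h
    rw [splitOp_congr (G := fun m d => poch q (s * (x * Y * q ^ a) * q ^ l) p *
      (poch q s d * hpoch q u Y d * poch q (s * x * Y * q ^ d) m)), splitOp_mul_left, h,
      show u * x * q ^ a * s = u * (s * x) * q ^ a by ring]
    · ring
    · intro m d hmd
      rw [add_comm p m, poch_add, show s * x * Y * q ^ d * q ^ m = s * (x * Y * q ^ a) * q ^ l by
        linear_combination s * x * Y * congrArg (q ^ ·) hmd]
      ring
  unfold vertexOp
  simp only [inner]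
  rw [exchange_mul_left]
  -- After cancelling common factors, the two sides differ by swapping `s` and `t` in `symSum` with
  -- `U = u * x * q ^ a` and `Z = x * Y * q ^ a`.
  have h := symSum_comm q (u * x * q ^ a) (x * Y * q ^ a) s t b
  unfold symSum at h
  rw [← h, mul_assoc (poch q (u * (s * x)) a), ← exchange_mul_left q s b (poch q (x * Y) a)]
  congr 1
  refine exchange_congr fun m l _ => ?_
  rw [poch_add, show u * (t * x) * q ^ a = u * x * q ^ a * t by ring,
    show t * x * Y * q ^ (a + l) = t * (x * Y * q ^ a) * q ^ l by ring]
  ring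

/-! ### Reduction to test functions, and specialisation of `q`. -/

/-- A linear functional on functions of two labels that only sees labels with sum `n` is a sum over
the antidiagonal. -/
lemma linearMap_eq_sum_antidiagonal (n : ℕ) (L : (ℕ → ℕ → R) →ₗ[R] R)
    (hL : ∀ F G : ℕ → ℕ → R, (∀ c d, c + d = n → F c d = G c d) → L F = L G) (F : ℕ → ℕ → R) :
    L F = ∑ p ∈ antidiagonal n,
      L (fun c d => if c = p.1 ∧ d = p.2 then 1 else 0) * F p.1 p.2 := by
  have e : L F = L (∑ p ∈ antidiagonal n,
      F p.1 p.2 • fun c d => if c = p.1 ∧ d = p.2 then 1 else 0) := by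
    refine hL _ _ fun c d h => ?_
    simp only [Finset.sum_apply, Pi.smul_apply, smul_eq_mul, mul_ite, mul_one, mul_zero]
    rw [Finset.sum_eq_single (c, d)]
    · simp
    · rintro ⟨a, b⟩ _ hne
      rw [if_neg]
      rintro ⟨rfl, rfl⟩
      exact hne rfl
    · simp [h]
  rw [e, map_sum]
  exact sum_congr rfl fun p _ => by rw [map_smul, smul_eq_mul, mul_comm]

/-- The polynomials `∏_{i<d} (u - X q^i)`. -/
def hpochSequence [IsDomain R] (q u : R) (hq : q ≠ 0) : Polynomial.Sequence R where
  elems' d := ∏ i ∈ range d, (Polynomial.C u - Polynomial.X * Polynomial.C (q ^ i))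
  degree_eq' d := by
    rw [Polynomial.degree_prod, sum_congr rfl (g := fun _ => (1 : WithBot ℕ))]
    · simp
    · intro i _
      rw [show Polynomial.C u - Polynomial.X * Polynomial.C (q ^ i) =
        Polynomial.C (-q ^ i) * Polynomial.X + Polynomial.C u by simp; ring]
      exact Polynomial.degree_linear (neg_ne_zero.2 (pow_ne_zero i hq))

lemma hpochSequence_eval [IsDomain R] (q u Y : R) (hq : q ≠ 0) (d : ℕ) :
    (hpochSequence q u hq d).eval Y = hpoch q u Y d := by
  simp [hpochSequence, hpoch, Polynomial.eval_prod]

/-- The test functions `hpoch q u Y` separate linear functionals. -/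
lemma linearMap_eq_zero_of_hpoch [IsDomain R] [Infinite R] (q u : R) (hq : q ≠ 0) (n : ℕ)
    (L : (ℕ → ℕ → R) →ₗ[R] R)
    (hL : ∀ F G : ℕ → ℕ → R, (∀ c d, c + d = n → F c d = G c d) → L F = L G)
    (h : ∀ Y, L (fun _ d => hpoch q u Y d) = 0) (F : ℕ → ℕ → R) : L F = 0 := by
  rw [linearMap_eq_sum_antidiagonal n L hL]
  set α : ℕ → ℕ → R := fun i j => L (fun c d => if c = i ∧ d = j then 1 else 0)
  have hP : ∑ j ∈ range (n + 1), α (n - j) j • hpochSequence q u hq j = 0 := by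
    refine Polynomial.funext fun Y => ?_
    have := h Y
    rw [linearMap_eq_sum_antidiagonal n L hL] at this
    rw [← Nat.sum_antidiagonal_swap, Nat.sum_antidiagonal_eq_sum_range_succ_mk] at this
    simpa [Polynomial.eval_finsetSum, hpochSequence_eval] using this
  -- The `d`-th test function has degree `d` in `Y`, so a vanishing combination has vanishing
  -- coefficients.
  have hα := linearIndependent_iff'.1 (hpochSequence q u hq).linearIndependent _ _ hP
  refine sum_eq_zero fun p hp => ?_
  have hp := mem_antidiagonal.1 hp
  have := hα p.2 (mem_range.2 (by omega))
  rw [show n - p.2 = p.1 by omega] at this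
  change α p.1 p.2 * _ = 0
  rw [this, zero_mul]

section Map

variable {S : Type*} [CommRing S] (f : R →+* S)

lemma map_poch (q a : R) (k : ℕ) : f (poch q a k) = poch (f q) (f a) k := by
  simp [poch]

lemma map_gauss (q : R) : ∀ i j, f (gauss q i j) = gauss (f q) i j
  | 0, _ => by simp
  | _ + 1, 0 => by simp
  | i + 1, j + 1 => by
    rw [gauss_succ_succ, gauss_succ_succ, map_add, map_mul, map_gauss q i, map_gauss q (i + 1) j,
      map_pow]

lemma map_gsum (q : R) (n : ℕ) (F : ℕ → ℕ → R) :
    f (gsum q n F) = gsum (f q) n fun i j => f (F i j) := by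
  simp [gsum, map_gauss]

lemma map_exchange (q s : R) (n : ℕ) (F : ℕ → ℕ → R) :
    f (exchange q s n F) = exchange (f q) (f s) n fun i j => f (F i j) := by
  simp [exchange, map_gsum, map_poch]

lemma map_splitOp (q x u : R) (n : ℕ) (F : ℕ → ℕ → R) :
    f (splitOp q x u n F) = splitOp (f q) (f x) (f u) n fun i j => f (F i j) := by
  simp [splitOp, map_gsum, map_poch]

lemma map_vertexOp (q x u t : R) (a b : ℕ) (F : ℕ → ℕ → R) :
    f (vertexOp q x u t a b F) =
      vertexOp (f q) (f x) (f u) (f t) a b fun i j => f (F i j) := by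
  simp [vertexOp, map_exchange, map_splitOp]

end Map

/-- Both sides are linear in `H` and see only labels with sum `a + b`, so the test functions of
`base_hpoch` suffice. -/
lemma base_of_isDomain [IsDomain R] [Infinite R] (q x u s t : R) (hq : q ≠ 0) (a b : ℕ)
    (H : ℕ → ℕ → R) :
    poch q (u * (s * x)) a * exchange q s b (fun m l => poch q (u * (t * x) * q ^ a) l *
        vertexOp q x u t (a + l) m H) =
      vertexOp q x u t a b fun k d => splitOp q (s * x) u k fun c e =>
        poch q s d * H c (e + d) := by
  rw [← sub_eq_zero]
  let L : (ℕ → ℕ → R) →ₗ[R] R :=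
    { toFun := fun H => poch q (u * (s * x)) a * exchange q s b (fun m l =>
          poch q (u * (t * x) * q ^ a) l * vertexOp q x u t (a + l) m H) -
        vertexOp q x u t a b fun k d => splitOp q (s * x) u k fun c e =>
          poch q s d * H c (e + d)
      map_add' := fun F G => by
        have e := vertexOp_add q x u t
        have e' : ∀ a b, vertexOp q x u t a b (F + G) =
          vertexOp q x u t a b F + vertexOp q x u t a b G := fun a b => e a b F G
        simp only [e', Pi.add_apply, mul_add, exchange_add, splitOp_add, vertexOp_add]
        ring
      map_smul' := fun r F => by
        have e' : ∀ a b, vertexOp q x u t a b (r • F) = r * vertexOp q x u t a b F :=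
          fun a b => vertexOp_mul_left q x u t a b r F
        simp only [e', Pi.smul_apply, smul_eq_mul, mul_left_comm _ r, exchange_mul_left,
          splitOp_mul_left, vertexOp_mul_left, RingHom.id_apply]
        ring }
  refine linearMap_eq_zero_of_hpoch q u hq (a + b) L (fun F G h => ?_) (fun Y => ?_) H
  · refine congrArg₂ (fun y z : R => y - z) (congrArg (fun z : R => _ * z) (exchange_congr fun m l hml => ?_))
      (vertexOp_congr fun k d hkd => splitOp_congr fun c e hce => ?_)
    · rw [vertexOp_congr fun c d hcd => h c d (by omega)]
    · rw [h c (e + d) (by omega)]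
  · exact sub_eq_zero.2 (base_hpoch q x u s t Y a b)

/-- The Yang–Baxter equation with `b₂ = 0` and `d₁ = 0`. -/
lemma base_identity [IsDomain R] (q x u s t : R) (a b : ℕ) (H : ℕ → ℕ → R) :
    poch q (u * (s * x)) a * exchange q s b (fun m l => poch q (u * (t * x) * q ^ a) l *
        vertexOp q x u t (a + l) m H) =
      vertexOp q x u t a b fun k d => splitOp q (s * x) u k fun c e =>
        poch q s d * H c (e + d) := by
  -- Over `R[X]` with `X` in place of `q`, the ring is infinite and the parameter is non-zero;
  -- evaluating at `q` then covers every `R` and `q`, including `q = 0`.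
  have h := congrArg (Polynomial.evalRingHom q) (base_of_isDomain (Polynomial.X : Polynomial R)
    (Polynomial.C x) (Polynomial.C u) (Polynomial.C s) (Polynomial.C t) Polynomial.X_ne_zero a b
    fun c d => Polynomial.C (H c d))
  simpa only [map_mul, map_pow, map_poch, map_exchange, map_vertexOp, map_splitOp,
    Polynomial.coe_evalRingHom, Polynomial.eval_X, Polynomial.eval_C] using h

end Ring

/-! ### The Yang–Baxter equation. -/

/-- The Yang–Baxter equation for the vertices `vertexOp`. -/
theorem yang_baxter {K : Type*} [Field K] (q x u s t t' : K) (hq : ∀ k : ℕ, 1 ≤ k → q ^ k ≠ 1)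
    (ht : t = t' * s) (a b₁ b₂ : ℕ) (F : ℕ → ℕ → ℕ → K) :
    exchange q s b₁ (fun m l => vertexOp q (s * x) u t' a l fun k d₁ =>
        vertexOp q x u t k (b₂ + m) fun c d₂ => F c d₁ d₂) =
      vertexOp q x u t a b₁ fun k d => vertexOp q (s * x) u t' k b₂ fun c e =>
        exchange q s d fun m l => F c l (e + m) := by
  have htx : t' * (s * x) = t * x := by rw [ht]; ring
  induction b₂ generalizing F with
  | succ b₂ ih =>
    have h := ih fun c d₁ d₂ => (1 - u * (t * x) * q ^ c) * F (c + 1) d₁ d₂ +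
      t * x * q ^ c * F c d₁ (d₂ + 1)
    simp only [vertexOp_succ_left q (s * x), htx]
    simp only [add_right_comm b₂ 1, vertexOp_succ_left q x]
    rw [h]
    simp only [exchange_add, exchange_mul_left, add_right_comm _ _ 1]
  | zero =>
    simp only [zero_add]
    induction hn : a + b₁ using Nat.strong_induction_on generalizing a b₁ F with
    | _ n ih =>
    -- `F` splits into its part at `d₁ = 0`, handled by `base_identity`, and a part in the form that
    -- the lowering lemmas accept. The division uses that `q` is not a root of unity.
    let G : ℕ → ℕ → ℕ → K := fun c d e => F c (d + 1) e / (1 - q ^ (d + 1))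
    have hF : F = fun c d e => (if d = 0 then F c 0 e else 0) + (1 - q ^ d) * G c (d - 1) e := by
      funext c d e
      rcases d with _ | d
      · simp
      · have : 1 - q ^ (d + 1) ≠ 0 := sub_ne_zero.2 (hq _ (by omega)).symm
        simp only [G, Nat.add_sub_cancel, Nat.add_eq_zero_iff, one_ne_zero, and_false, if_false]
        field_simp
        ring
    have h0 : exchange q s b₁ (fun m l => vertexOp q (s * x) u t' a l fun k d₁ =>
          vertexOp q x u t k m fun c d₂ => if d₁ = 0 then F c 0 d₂ else 0) =
        vertexOp q x u t a b₁ fun k d => vertexOp q (s * x) u t' k 0 fun c e =>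
          exchange q s d fun m l => if l = 0 then F c 0 (e + m) else 0 := by
      have e : ∀ m k d₁, vertexOp q x u t k m (fun c d₂ => if d₁ = 0 then F c 0 d₂ else 0) =
          if d₁ = 0 then vertexOp q x u t k m (fun c d₂ => F c 0 d₂) else 0 := by
        intro m k d₁
        by_cases hd : d₁ = 0
        · simp [hd]
        · simpa [hd] using vertexOp_mul_left q x u t k m 0 fun _ _ => 0
      simp only [e, vertexOp_no_exit, htx, mul_assoc (poch q (u * (s * x)) a), exchange_mul_left,
        vertexOp_zero_right, exchange_no_stay q s _ fun m => F _ 0 (_ + m)]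
      exact base_identity q x u s t a b₁ fun c d => F c 0 d
    have h1 : exchange q s b₁ (fun m l => vertexOp q (s * x) u t' a l fun k d₁ =>
          vertexOp q x u t k m fun c d₂ => (1 - q ^ d₁) * G c (d₁ - 1) d₂) =
        vertexOp q x u t a b₁ fun k d => vertexOp q (s * x) u t' k 0 fun c e =>
          exchange q s d fun m l => (1 - q ^ l) * G c (l - 1) (e + m) := by
      have eL := fun m => vertexOp_lower_right q (s * x) u t' a (F := fun k d₁ =>
        vertexOp q x u t k m fun c d₂ => G c d₁ d₂)
      have eR := fun c e d => exchange_lower q s d fun m l => G c l (e + m)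
      have eV := vertexOp_lower_right q x u t a b₁ fun k d =>
        vertexOp q (s * x) u t' k 0 fun c e => exchange q s d fun m l => G c l (e + m)
      have eX := exchange_lower q s b₁ fun m l => vertexOp q (s * x) u t' a l fun k d₁ =>
        vertexOp q x u t k m fun c d₂ => G c d₁ d₂
      -- Lowering leaves one particle fewer in `a` or in `b₁`, so induction applies; when that label
      -- is `0` the prefactor vanishes.
      have i1 : (1 - q ^ a) * exchange q s b₁ (fun m l =>
            vertexOp q (s * x) u t' (a - 1) l fun k d₁ =>
              vertexOp q x u t k m fun c d₂ => G c d₁ d₂) =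
          (1 - q ^ a) * vertexOp q x u t (a - 1) b₁ fun k d => vertexOp q (s * x) u t' k 0
            fun c e => exchange q s d fun m l => G c l (e + m) := by
        rcases a with _ | a
        · simp
        · rw [ih _ (by omega) _ _ _ rfl]
      have i2 : (1 - q ^ b₁) * exchange q s (b₁ - 1) (fun m l =>
            vertexOp q (s * x) u t' a l fun k d₁ =>
              vertexOp q x u t k m fun c d₂ => G c d₁ d₂) =
          (1 - q ^ b₁) * vertexOp q x u t a (b₁ - 1) fun k d => vertexOp q (s * x) u t' k 0
            fun c e => exchange q s d fun m l => G c l (e + m) := by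
        rcases b₁ with _ | b
        · simp
        · rw [ih _ (by omega) _ _ _ rfl]
      simp only [vertexOp_mul_left, eL, eR, htx, exchange_add, exchange_mul_left, mul_assoc] at eV eX ⊢
      rw [eX, eV]
      linear_combination s * x * i1 + t * x * q ^ a * s * i2
    rw [hF]
    simp only [vertexOp_add, exchange_add]
    rw [h0, h1]

/-! ### From vertex weights to one and two rows. -/

section Rows

variable {K : Type*} [Field K]

lemma poch_self_add (q : K) (m d : ℕ) :
    poch q q (m + d) = poch q q m * poch q q d * gauss q m d := by
  induction m with
  | zero => simp
  | succ m ih =>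
    have h := (one_sub_mul_gauss_succ q m d).1
    rw [add_right_comm, poch_succ, ih, poch_succ, ← pow_succ', ← pow_succ']
    linear_combination - poch q q m * poch q q d * h

lemma qBinomial_eq_gauss {q : K} (hq : ∀ k : ℕ, 1 ≤ k → q ^ k ≠ 1) (m d : ℕ) :
    qBinomial q (m + d) m = gauss q m d := by
  have hp : ∀ k, poch q q k ≠ 0 := fun k => prod_ne_zero_iff.2 fun i _ => by
    rw [← pow_succ']
    exact sub_ne_zero.2 (hq _ (by omega)).symm
  have h := poch_self_add q m d
  change poch q q (m + d) / (poch q q (m + d - m) * poch q q m) = _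
  rw [Nat.add_sub_cancel_left, h, mul_comm (poch q q d), mul_div_assoc, mul_comm,
    div_mul_cancel₀ _ (mul_ne_zero (hp m) (hp d))]

lemma weight_zero (q x u v : K) : weight q x u v 0 0 0 0 = 1 := by
  simp [weight, qPochhammer, qBinomial]

lemma add_eq_add_of_weight_ne_zero {q x u v : K} {a b c d : ℕ} (h : weight q x u v a b c d ≠ 0) :
    a + b = c + d := by
  by_contra hne
  exact h (if_neg hne)

/-- The index `p` in `weight` counts the left particles sent straight up by `exchange`. The
bijection is `((p, l), (m, d)) ↔ ((p + m, d), p)`. -/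
lemma vertexOp_eq_sum_weight {q : K} (hq : ∀ k : ℕ, 1 ≤ k → q ^ k ≠ 1) (x u v : K) (a b : ℕ)
    (F : ℕ → ℕ → K) :
    vertexOp q x u (v / x) a b F =
      ∑ p ∈ antidiagonal (a + b), weight q x u v a b p.1 p.2 * F p.1 p.2 := by
  have e : ∀ p ∈ antidiagonal (a + b), weight q x u v a b p.1 p.2 * F p.1 p.2 =
      ∑ r ∈ range (min b p.1 + 1), poch q (v / x) r * (v / x) ^ (b - r) * gauss q r (b - r) *
        (poch q (u * x) (p.1 - r) * x ^ p.2 * gauss q (p.1 - r) p.2) * F p.1 p.2 := by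
    intro p hp
    rw [weight, if_pos (mem_antidiagonal.1 hp).symm, mul_sum, sum_mul]
    refine sum_congr rfl fun r hr => ?_
    have hr : r ≤ min b p.1 := by simpa [Nat.lt_succ_iff] using hr
    have h1 := qBinomial_eq_gauss hq r (b - r)
    have h2 := qBinomial_eq_gauss hq (p.1 - r) p.2
    rw [show r + (b - r) = b by omega] at h1
    rw [show p.1 - r + p.2 = p.1 + p.2 - r by omega] at h2
    rw [h1, h2]
    simp only [poch, qPochhammer]
    ring
  rw [sum_congr rfl e]
  simp only [vertexOp, exchange, splitOp, gsum, mul_sum]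
  rw [sum_sigma', sum_sigma']
  refine sum_bij' (fun z _ => ⟨(z.1.1 + z.2.1, z.2.2), z.1.1⟩)
    (fun z _ => ⟨(z.2, b - z.2), (z.1.1 - z.2, z.1.2)⟩) ?_ ?_ ?_ ?_ ?_
  · rintro ⟨⟨p, l⟩, ⟨m, d⟩⟩ h
    simp only [mem_sigma, HasAntidiagonal.mem_antidiagonal, mem_range] at h ⊢
    omega
  · rintro ⟨⟨c, d⟩, p⟩ h
    simp only [mem_sigma, HasAntidiagonal.mem_antidiagonal, mem_range] at h ⊢
    omega
  · rintro ⟨⟨p, l⟩, ⟨m, d⟩⟩ h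
    simp only [mem_sigma, HasAntidiagonal.mem_antidiagonal] at h
    obtain rfl := h.1
    simp only [Nat.add_sub_cancel_left]
  · rintro ⟨⟨c, d⟩, p⟩ h
    simp only [mem_sigma, HasAntidiagonal.mem_antidiagonal, mem_range] at h
    simp only [show p + (c - p) = c by omega]
  · rintro ⟨⟨p, l⟩, ⟨m, d⟩⟩ h
    simp only [mem_sigma, HasAntidiagonal.mem_antidiagonal] at h
    obtain rfl := h.1
    simp only [Nat.add_sub_cancel_left]
    ring

section Row

variable {M : Type*} [AddCommGroup M] [Module K M] {M' : Type*} [AddCommGroup M'] [Module K M']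

/-- The row with columns `n - 1, …, 0`, bottom state `i` and left label `b`, as a functional on
functions of the top state and the right label. -/
def rowOp (q : K) (u v : ℕ → K) (x : K) (i : State) : ℕ → ℕ → (State → ℕ → M) → M
  | 0, b, F => F 0 b
  | n + 1, b, F => ∑ p ∈ antidiagonal (i n + b), weight q x (u n) (v n) (i n) b p.1 p.2 •
      rowOp q u v x i n p.2 fun k e => F (k + Finsupp.single n p.1) e

variable (q : K) (u v : ℕ → K) (x : K)

lemma map_rowOp (L : M →ₗ[K] M') (i : State) (n b : ℕ) (F : State → ℕ → M) :
    L (rowOp q u v x i n b F) = rowOp q u v x i n b fun k e => L (F k e) := by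
  induction n generalizing b F with
  | zero => rfl
  | succ n ih => simp [rowOp, map_sum, ih]

lemma rowOp_congr {i i' : State} {n b : ℕ} {F G : State → ℕ → M} (hi : ∀ j < n, i j = i' j)
    (h : ∀ k e, (∀ j, n ≤ j → k j = 0) → F k e = G k e) :
    rowOp q u v x i n b F = rowOp q u v x i' n b G := by
  induction n generalizing b F G with
  | zero => exact h 0 b fun _ _ => rfl
  | succ n ih =>
    simp only [rowOp, hi n (Nat.lt_succ_self n)]
    refine sum_congr rfl fun p _ => ?_
    rw [ih (fun j hj => hi j (by omega)) fun k e hk => h _ e fun j hj => ?_]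
    simp [hk j (by omega), show n ≠ j by omega]

lemma rowOp_sum_smul {ι : Type*} (s : Finset ι) (c : ι → K) (i : State) (n b : ℕ)
    (F : ι → State → ℕ → M) :
    rowOp q u v x i n b (fun k e => ∑ r ∈ s, c r • F r k e) =
      ∑ r ∈ s, c r • rowOp q u v x i n b (F r) := by
  induction n generalizing b F with
  | zero => rfl
  | succ n ih =>
    simp only [rowOp, ih, smul_sum]
    rw [sum_comm]
    simp only [smul_comm (c _)]

lemma rowOp_zero (i : State) (n b : ℕ) : rowOp q u v x i n b (fun _ _ => (0 : M)) = 0 := by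
  simpa using rowOp_sum_smul q u v x (∅ : Finset ℕ) 0 i n b fun _ _ _ => (0 : M)

/-- Left of the support of `i`, with left label `0`, only the empty vertex of weight `1` occurs. -/
lemma rowOp_eq_of_le {i : State} {N N' : ℕ} (h : N ≤ N') (hi : ∀ j, N ≤ j → i j = 0)
    (F : State → ℕ → M) : rowOp q u v x i N' 0 F = rowOp q u v x i N 0 F := by
  induction N', h using Nat.le_induction with
  | base => rfl
  | succ n hn ih => simp [rowOp, hi n hn, weight_zero, ih]

/-- Two rows, the lower one with parameter `x`, the upper one with parameter `y`. -/
def pairOp (y : K) (i : State) (n b₁ b₂ : ℕ) (F : State → ℕ → ℕ → M) : M :=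
  rowOp q u v x i n b₁ fun k e₁ => rowOp q u v y k n b₂ fun k' e₂ => F k' e₁ e₂

/-- The upper vertex in column `n` meets the lower row only through the label `p.1`, so it may be
summed before the remaining lower columns. -/
lemma pairOp_succ (y : K) (i : State) (n b₁ b₂ : ℕ) (F : State → ℕ → ℕ → M) :
    pairOp q u v x y i (n + 1) b₁ b₂ F =
      ∑ p ∈ antidiagonal (i n + b₁), weight q x (u n) (v n) (i n) b₁ p.1 p.2 •
        ∑ r ∈ antidiagonal (p.1 + b₂), weight q y (u n) (v n) p.1 b₂ r.1 r.2 •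
          pairOp q u v x y i n p.2 r.2 fun k => F (k + Finsupp.single n r.1) := by
  rw [pairOp, rowOp]
  refine sum_congr rfl fun p _ => ?_
  congr 1
  simp only [pairOp]
  rw [← rowOp_sum_smul]
  refine rowOp_congr q u v x (fun _ _ => rfl) fun k e hk => ?_
  have hn : (k + Finsupp.single n p.1) n = p.1 := by simp [hk n le_rfl]
  rw [rowOp, hn]
  refine sum_congr rfl fun r _ => ?_
  congr 1
  refine rowOp_congr q u v y (fun j hj => ?_) fun _ _ _ => rfl
  simp [show n ≠ j by omega]

end Row

lemma pairOp_succ_eq_vertexOp {q : K} (hq : ∀ k : ℕ, 1 ≤ k → q ^ k ≠ 1) (u v : ℕ → K) (x y : K)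
    (i : State) (n b₁ b₂ : ℕ) (F : State → ℕ → ℕ → K) :
    pairOp q u v x y i (n + 1) b₁ b₂ F =
      vertexOp q x (u n) (v n / x) (i n) b₁ fun k d₁ => vertexOp q y (u n) (v n / y) k b₂
        fun c d₂ => pairOp q u v x y i n d₁ d₂ fun k => F (k + Finsupp.single n c) := by
  simp only [pairOp_succ, vertexOp_eq_sum_weight hq, smul_eq_mul]

/-- Moving the exchange matrix through two rows of the lattice. -/
lemma exchange_pairOp {q : K} (hq : ∀ k : ℕ, 1 ≤ k → q ^ k ≠ 1) (u v : ℕ → K) {x y : K}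
    (hx : x ≠ 0) (hy : y ≠ 0) (i : State) (n b₁ b₂ : ℕ) (F : State → ℕ → ℕ → K) :
    exchange q (y / x) b₁ (fun m l => pairOp q u v y x i n l (b₂ + m) F) =
      pairOp q u v x y i n b₁ b₂ fun k e₁ e₂ =>
        exchange q (y / x) e₁ fun m l => F k l (e₂ + m) := by
  induction n generalizing b₁ b₂ F with
  | zero => rfl
  | succ n ih =>
    simp only [pairOp_succ_eq_vertexOp hq]
    have hyx : y = y / x * x := (div_mul_cancel₀ y hx).symm
    have h := yang_baxter q x (u n) (y / x) (v n / x) (v n / y) hq (by field_simp) (i n) b₁ b₂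
      fun c d₁ d₂ => pairOp q u v y x i n d₁ d₂ fun k => F (k + Finsupp.single n c)
    rw [← hyx] at h
    rw [h]
    simp only [ih]

/-- The functional attached to two rows does not depend on the order of the rows. -/
lemma pairOp_comm {q : K} (hq : ∀ k : ℕ, 1 ≤ k → q ^ k ≠ 1) (u v : ℕ → K) {x y : K}
    (hx : x ≠ 0) (hy : y ≠ 0) (i : State) (n : ℕ) (F : State → K) :
    pairOp q u v y x i n 0 0 (fun k _ _ => F k) = pairOp q u v x y i n 0 0 fun k _ _ => F k := by
  -- Empty left labels make the exchange matrix trivial on one side; on the other, `F` ignores the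
  -- right labels and `exchange_one` applies.
  have h := exchange_pairOp hq u v hx hy i n 0 0 fun k _ _ => F k
  rw [exchange_zero] at h
  rw [h]
  congr 1
  funext k e _
  simpa [exchange_one] using exchange_mul_left q (y / x) e (F k) fun _ _ => 1

end Rows

/-! ### Identification with `rowWeight`, and commuting transfer matrices. -/

section Transfer

variable {K : Type*} [Field K] (q : K) (u v : ℕ → K) (x : K)

/-- The horizontal labels of the columns `n - 1, …, 0`, determined by the left label `b` and
particle conservation. -/
def rowLabels (i k : State) : ℕ → ℕ → ℕ →₀ ℕ
  | 0, b => Finsupp.single 0 b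
  | n + 1, b => rowLabels i k n (i n + b - k n) + Finsupp.single (n + 1) b

lemma rowLabels_of_lt (i k : State) {n b j : ℕ} (h : n < j) : rowLabels i k n b j = 0 := by
  induction n generalizing b with
  | zero => simp [rowLabels, show 0 ≠ j by omega]
  | succ n ih => simp [rowLabels, ih (show n < j by omega), show n + 1 ≠ j by omega]

lemma rowLabels_self (i k : State) (n b : ℕ) : rowLabels i k n b n = b := by
  cases n with
  | zero => simp [rowLabels]
  | succ n => simp [rowLabels, rowLabels_of_lt i k (Nat.lt_succ_self n)]

lemma rowLabels_succ (i k : State) (n b : ℕ) {j : ℕ} (h : j ≤ n) :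
    rowLabels i k (n + 1) b j = rowLabels i k n (i n + b - k n) j := by
  simp [rowLabels, show n + 1 ≠ j by omega]

lemma eq_rowLabels {i k h : State} {n : ℕ} (hc : ∀ j < n, i j + h (j + 1) = k j + h j) :
    ∀ j ≤ n, h j = rowLabels i k n (h n) j := by
  induction n with
  | zero =>
    intro j hj
    obtain rfl : j = 0 := by omega
    simp [rowLabels]
  | succ n ih =>
    intro j hj
    rcases Nat.lt_or_ge n j with h1 | h1
    · obtain rfl : j = n + 1 := by omega
      rw [rowLabels_self]
    · rw [rowLabels_succ i k n _ h1, ih (fun j hj => hc j (by omega)) j h1,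
        hc n (Nat.lt_succ_self n), Nat.add_sub_cancel_left]

/-- The coefficients of `rowOp`. -/
lemma rowOp_single {k : State} (i : State) (n b : ℕ) (hk : ∀ j, n ≤ j → k j = 0) :
    rowOp q u v x i n b (fun k' _ => if k' = k then (1 : K) else 0) =
      ∏ j ∈ range n, weight q x (u j) (v j) (i j) (rowLabels i k n b (j + 1)) (k j)
        (rowLabels i k n b j) := by
  -- The induction erases column `n` from the target `k`, while labels and weights keep referring to
  -- the unerased `k₀`.
  suffices H : ∀ (n b : ℕ) (k k₀ : State), (∀ j < n, k j = k₀ j) → (∀ j, n ≤ j → k j = 0) →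
      rowOp q u v x i n b (fun k' _ => if k' = k then (1 : K) else 0) =
      ∏ j ∈ range n, weight q x (u j) (v j) (i j) (rowLabels i k₀ n b (j + 1)) (k₀ j)
        (rowLabels i k₀ n b j) from H n b k k (fun _ _ => rfl) hk
  intro n
  induction n with
  | zero =>
    intro b k k₀ _ hk
    have : k = 0 := Finsupp.ext fun j => hk j (by omega)
    simp [rowOp, this]
  | succ n ih =>
    intro b k k₀ h0 hk
    have step : ∀ p : ℕ × ℕ, rowOp q u v x i n p.2 (fun k' _ =>
        if k' + Finsupp.single n p.1 = k then (1 : K) else 0) = if p.1 = k₀ n then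
        rowOp q u v x i n p.2 (fun k' _ => if k' = k.erase n then (1 : K) else 0) else 0 := by
      intro p
      split_ifs with hp
      · refine rowOp_congr q u v x (fun _ _ => rfl) fun k' _ hk' => ?_
        congr 1
        rw [eq_iff_iff]
        constructor
        · rintro rfl
          ext j
          by_cases hj : j = n
          · subst hj; simp [hk' j le_rfl]
          · simp [hj]
        · rintro rfl
          rw [hp, ← h0 n (Nat.lt_succ_self n), add_comm, Finsupp.single_add_erase]
      · refine (rowOp_congr q u v x (G := fun _ _ => 0) (fun _ _ => rfl)
          fun k' _ hk' => ?_).trans (rowOp_zero q u v x i n p.2)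
        rw [if_neg]
        rintro rfl
        exact hp (by simp [← h0 n (Nat.lt_succ_self n), hk' n le_rfl])
    rw [rowOp, prod_range_succ, rowLabels_self, rowLabels_succ i k₀ n b le_rfl, rowLabels_self]
    simp only [step, smul_eq_mul]
    have hprod : ∏ j ∈ range n, weight q x (u j) (v j) (i j) (rowLabels i k₀ (n + 1) b (j + 1))
        (k₀ j) (rowLabels i k₀ (n + 1) b j) = rowOp q u v x i n (i n + b - k₀ n)
          (fun k' _ => if k' = k.erase n then (1 : K) else 0) := by
      rw [ih _ (k.erase n) k₀]
      · refine prod_congr rfl fun j hj => ?_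
        have hj := mem_range.1 hj
        rw [rowLabels_succ i k₀ n b (by omega), rowLabels_succ i k₀ n b (by omega)]
      · intro j hj
        simp [hj.ne, h0 j (by omega)]
      · intro j hj
        by_cases hjn : j = n
        · simp [hjn]
        · simp [hjn, hk j (by omega)]
    rw [hprod]
    by_cases hle : k₀ n ≤ i n + b
    · rw [sum_eq_single (k₀ n, i n + b - k₀ n)]
      · simp [mul_comm]
      · rintro ⟨c, d⟩ hcd hne
        rw [HasAntidiagonal.mem_antidiagonal] at hcd
        rw [if_neg, mul_zero]
        rintro rfl
        apply hne
        simp only [Prod.mk.injEq, true_and]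
        simp only at hcd
        omega
      · intro h
        exact absurd (by simp only [HasAntidiagonal.mem_antidiagonal]; omega) h
    -- Here the subtraction in `rowLabels` truncates: conservation fails and both sides are `0`.
    · rw [sum_eq_zero, weight, if_neg (by omega), mul_zero]
      rintro ⟨c, d⟩ hcd
      rw [HasAntidiagonal.mem_antidiagonal] at hcd
      simp only at hcd
      rw [if_neg (by simp only; omega), mul_zero]

/-- Conservation and the empty left boundary leave `rowLabels i k N' 0` as the only labelling that
can contribute. -/
lemma rowWeight_eq_rowOp {i : State} {N : ℕ} (hi : ∀ j, N ≤ j → i j = 0) (k : State) :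
    rowWeight q u v x i k = rowOp q u v x i N 0 fun k' _ => if k' = k then (1 : K) else 0 := by
  obtain ⟨N', hN, hk⟩ : ∃ N', N ≤ N' ∧ ∀ j, N' ≤ j → k j = 0 := by
    refine ⟨N + (k.support.sup id + 1), by omega, fun j hj => ?_⟩
    by_contra h
    have : j ≤ k.support.sup id := Finset.le_sup (f := id) (Finsupp.mem_support_iff.2 h)
    omega
  have hi' : ∀ j, N' ≤ j → i j = 0 := fun j hj => hi j (hN.trans hj)
  rw [← rowOp_eq_of_le q u v x hN hi, rowOp_single q u v x i N' 0 hk, rowWeight]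
  have hfin : ∀ (h : ℕ →₀ ℕ) (m : ℕ), N' ≤ m → (∀ j, m ≤ j → h j = 0) →
      ∏ᶠ j, weight q x (u j) (v j) (i j) (h (j + 1)) (k j) (h j) =
        ∏ j ∈ range m, weight q x (u j) (v j) (i j) (h (j + 1)) (k j) (h j) := by
    intro h m hm hh
    refine finprod_eq_prod_of_mulSupport_subset _ fun j hj => ?_
    rw [coe_range, Set.mem_Iio]
    by_contra hjm
    apply hj
    simp only
    rw [hi' j (by omega), hk j (by omega), hh j (by omega), hh (j + 1) (by omega), weight_zero]
  rw [finsum_eq_single _ (rowLabels i k N' 0)]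
  · refine hfin _ N' le_rfl fun j hj => ?_
    rcases hj.eq_or_lt with rfl | hj
    · exact rowLabels_self ..
    · exact rowLabels_of_lt i k hj
  · intro h hne
    by_contra hprod
    apply hne
    set m := N' + (h.support.sup id + 1)
    have hm : ∀ j, m ≤ j → h j = 0 := fun j hj => by
      by_contra h0
      have : j ≤ h.support.sup id := Finset.le_sup (f := id) (Finsupp.mem_support_iff.2 h0)
      omega
    rw [hfin h m (by omega) hm] at hprod
    replace hprod := prod_ne_zero_iff.1 hprod
    have hc : ∀ j < m, i j + h (j + 1) = k j + h j := fun j hj =>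
      add_eq_add_of_weight_ne_zero (hprod j (mem_range.2 hj))
    -- Beyond `N'` both `i` and `k` vanish, so conservation carries the zero of `h` from far left
    -- down to `N'`.
    have h0 : ∀ j, N' ≤ j → h j = 0 := by
      intro j hj
      rcases Nat.lt_or_ge j m with hjm | hjm
      · induction hd : m - j generalizing j with
        | zero => omega
        | succ d ih =>
          have := hc j hjm
          rw [hi' j hj, hk j hj] at this
          rcases Nat.lt_or_ge (j + 1) m with h1 | h1
          · have := ih (j + 1) (by omega) h1 (by omega)
            omega
          · have := hm (j + 1) h1
            omega
      · exact hm j hjm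
    ext j
    rcases Nat.lt_or_ge N' j with hj | hj
    · rw [rowLabels_of_lt i k hj, h0 j hj.le]
    · have := eq_rowLabels (n := N') (fun j hj => hc j (by omega)) j hj
      rwa [h0 N' le_rfl] at this

lemma finsum_single (f : State →₀ K) : ∑ᶠ k : State, Finsupp.single k (f k) = f := by
  rw [finsum_eq_sum_of_support_subset (s := f.support)]
  · exact Finsupp.sum_single f
  · intro k hk
    simpa using hk

/-- The row weights are the coordinates of a finitely supported vector, so the `finsum` in
`transfer` does not fall back to its default value `0`. -/
lemma transfer_single {i : State} {N : ℕ} (hi : ∀ j, N ≤ j → i j = 0) :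
    transfer q u v x (Finsupp.single i 1) =
      rowOp q u v x i N 0 fun k _ => Finsupp.single k (1 : K) := by
  have h : ∀ k, rowWeight q u v x i k =
      (rowOp q u v x i N 0 fun k _ => Finsupp.single k (1 : K)) k := by
    intro k
    have := map_rowOp q u v x (Finsupp.lapply k : (State →₀ K) →ₗ[K] K) i N 0
      fun k _ => Finsupp.single k (1 : K)
    rw [Finsupp.lapply_apply] at this
    rw [this, rowWeight_eq_rowOp q u v x hi]
    congr 1
    funext k' _
    rw [Finsupp.lapply_apply, Finsupp.single_apply]
  rw [transfer, Finsupp.linearCombination_single, one_smul]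
  simp only [h, finsum_single]

lemma exists_state_bound (i : State) : ∃ N, ∀ j, N ≤ j → i j = 0 := by
  refine ⟨i.support.sup id + 1, fun j hj => ?_⟩
  by_contra h
  have : j ≤ i.support.sup id := Finset.le_sup (f := id) (Finsupp.mem_support_iff.2 h)
  omega

variable {q x} in
/-- The transfer matrices commute. -/
theorem commute_transfer (hq : ∀ k : ℕ, 1 ≤ k → q ^ k ≠ 1) {y : K} (hx : x ≠ 0) (hy : y ≠ 0) :
    Commute (transfer q u v x) (transfer q u v y) := by
  have key : ∀ (y x : K) (i k : State) (N : ℕ), (∀ j, N ≤ j → i j = 0) →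
      (transfer q u v x (transfer q u v y (Finsupp.single i 1))) k =
        pairOp q u v y x i N 0 0 fun k' _ _ => (Finsupp.single k' (1 : K)) k := by
    intro y x i k N hi
    rw [transfer_single q u v y hi, map_rowOp, ← Finsupp.lapply_apply (R := K) k, map_rowOp, pairOp]
    refine rowOp_congr q u v y (fun _ _ => rfl) fun k' _ hk' => ?_
    rw [transfer_single q u v x hk', map_rowOp]
    rfl
  refine Finsupp.lhom_ext' fun i => LinearMap.ext_ring (Finsupp.ext fun k => ?_)
  obtain ⟨N, hi⟩ := exists_state_bound i
  simp only [LinearMap.comp_apply, Module.End.mul_apply, Finsupp.lsingle_apply]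
  rw [key y x i k N hi, key x y i k N hi, pairOp_comm hq u v hx hy]

end Transfer

/-! ### Polynomial dependence on the spectral parameters. -/

section Polynomiality

open MvPolynomial

variable {F : Type w} [Field F] (q : F)

/-- Up to the factors `x ^ d` and `x ^ b`, the vertex weight is a polynomial in `x`. -/
lemma exists_poly_weight {σ : Type*} (u v : F) (r : σ) (a b c d : ℕ) :
    ∃ P : MvPolynomial σ F, ∀ (K : Type w) [Field K] [Algebra F K] (x : σ → K), (∀ i, x i ≠ 0) →
      x r ^ b * weight (algebraMap F K q) (x r) (algebraMap F K u) (algebraMap F K v) a b c d =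
        aeval x P * x r ^ d := by
  by_cases h : a + b = c + d
  swap
  · exact ⟨0, fun K _ _ x _ => by simp [weight, if_neg h]⟩
  refine ⟨∑ p ∈ range (min b c + 1), (∏ i ∈ range (c - p), (1 - C u * X r * C q ^ i)) *
    (∏ i ∈ range p, (X r - C v * C q ^ i)) * C v ^ (b - p) *
      C (qBinomial q (c + d - p) (c - p)) * C (qBinomial q b p), fun K _ _ x hx => ?_⟩
  have hbin : ∀ m k, algebraMap F K (qBinomial q m k) = qBinomial (algebraMap F K q) m k := by
    intro m k
    simp [qBinomial, qPochhammer]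
  rw [weight, if_pos h, map_sum, sum_mul, mul_sum, mul_sum]
  refine sum_congr rfl fun p hp => ?_
  have hp : p ≤ b := by
    have := mem_range.1 hp
    omega
  -- Of the `b` factors `x r`, `p` clear the Pochhammer symbol and `b - p` clear the power of `v /
  -- x`.
  have e : x r ^ b * (qPochhammer (algebraMap F K q) (algebraMap F K v / x r) p *
      (algebraMap F K v / x r) ^ (b - p)) =
      (∏ i ∈ range p, (x r - algebraMap F K v * algebraMap F K q ^ i)) *
        algebraMap F K v ^ (b - p) := by
    obtain ⟨l, rfl⟩ := Nat.exists_eq_add_of_le hp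
    rw [Nat.add_sub_cancel_left, pow_add, mul_mul_mul_comm, ← mul_pow, mul_div_cancel₀ _ (hx r)]
    congr 1
    have : x r ^ p = ∏ _i ∈ range p, x r := by simp
    rw [this, qPochhammer, ← prod_mul_distrib]
    refine prod_congr rfl fun i _ => ?_
    field_simp [hx r]
  simp only [map_mul, map_prod, map_sub, map_one, map_pow, aeval_X, aeval_C, hbin]
  rw [show ∏ i ∈ range (c - p), (1 - algebraMap F K u * x r * algebraMap F K q ^ i) =
    qPochhammer (algebraMap F K q) (algebraMap F K u * x r) (c - p) from rfl, ← mul_assoc, mul_right_comm _ _ (x r ^ d)]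
  linear_combination x r ^ d * qPochhammer (algebraMap F K q) (algebraMap F K u * x r) (c - p) *
    qBinomial (algebraMap F K q) (c + d - p) (c - p) * qBinomial (algebraMap F K q) b p * e

/-- The right label of a column is the left label of the next, so the powers of `x r` telescope and
only that of the outer left label `b` remains. -/
lemma exists_poly_rowOp {σ : Type*} (u v : ℕ → F) (r : σ) (i : State) (n b : ℕ)
    (G : State → MvPolynomial σ F) :
    ∃ P : MvPolynomial σ F, ∀ (K : Type w) [Field K] [Algebra F K] (x : σ → K), (∀ i, x i ≠ 0) →
      x r ^ b * rowOp (algebraMap F K q) (fun j => algebraMap F K (u j))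
        (fun j => algebraMap F K (v j)) (x r) i n b (fun k _ => aeval x (G k)) = aeval x P := by
  induction n generalizing b G with
  | zero => exact ⟨X r ^ b * G 0, fun K _ _ x _ => by simp [rowOp]⟩
  | succ n ih =>
    choose P hP using fun p : ℕ × ℕ => ih p.2 fun k => G (k + Finsupp.single n p.1)
    choose Q hQ using fun p : ℕ × ℕ => exists_poly_weight q (u n) (v n) r (i n) b p.1 p.2
    refine ⟨∑ p ∈ antidiagonal (i n + b), Q p * P p, fun K _ _ x hx => ?_⟩
    simp only [rowOp, smul_eq_mul, mul_sum, map_sum, map_mul]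
    refine sum_congr rfl fun p _ => ?_
    rw [← hP p K x hx, ← mul_assoc, hQ p K x hx, mul_assoc]

/-- The matrix elements of a product of transfer matrices are polynomials. -/
lemma exists_poly_prod_transfer (u v : ℕ → F) (k : State) (n : ℕ) (i : State) :
    ∃ P : MvPolynomial (Fin n) F, ∀ (K : Type w) [Field K] [Algebra F K] (x : Fin n → K),
      (∀ i, x i ≠ 0) →
      ((List.ofFn fun r : Fin n => transfer (algebraMap F K q) (fun j => algebraMap F K (u j))
        (fun j => algebraMap F K (v j)) (x r)).prod (Finsupp.single i 1)) k = aeval x P := by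
  induction n generalizing i with
  | zero =>
    refine ⟨if i = k then 1 else 0, fun K _ _ x _ => ?_⟩
    split_ifs with h <;> simp [h]
  | succ n ih =>
    choose P hP using ih
    obtain ⟨N, hi⟩ := exists_state_bound i
    -- The bottom row acts first and carries the last variable; the rows above use the variables
    -- embedded by `Fin.castSucc`.
    obtain ⟨Q, hQ⟩ := exists_poly_rowOp q u v (Fin.last n) i N 0
      fun k' => rename Fin.castSucc (P k')
    refine ⟨Q, fun K _ _ x hx => ?_⟩
    rw [← hQ K x hx, pow_zero, one_mul, List.ofFn_succ', List.concat_eq_append, List.prod_append,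
      List.prod_singleton, Module.End.mul_apply, transfer_single _ _ _ _ hi, map_rowOp,
      ← Finsupp.lapply_apply (R := K) k, map_rowOp]
    congr 1
    funext k' _
    rw [Finsupp.lapply_apply, hP k' K (fun r => x r.castSucc) fun r => hx _, aeval_rename]
    rfl

end Polynomiality

/-! ### Symmetry of the polynomial. -/

/-- The skew functions are given by symmetric polynomials. -/
theorem exists_symmetric_poly_skewG {F : Type w} [Field F] (q : F)
    (hq : ∀ k : ℕ, 1 ≤ k → q ^ k ≠ 1) (u v : ℕ → F) (lam mu : YoungDiagram) (n : ℕ) :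
    ∃ P : MvPolynomial (Fin n) F,
      (∀ (K : Type w) [Field K] [Algebra F K] (x : Fin n → K), (∀ i, x i ≠ 0) →
        skewG (algebraMap F K q) (fun j => algebraMap F K (u j))
          (fun j => algebraMap F K (v j)) lam mu x = MvPolynomial.aeval x P) ∧
      ∀ σ : Equiv.Perm (Fin n), MvPolynomial.rename σ P = P := by
  obtain ⟨P, hP⟩ := exists_poly_prod_transfer q u v (columnState mu) n (columnState lam)
  refine ⟨P, hP, fun σ => ?_⟩
  let A := MvPolynomial (Fin n) F
  -- At the generic point, with values in the fraction field, evaluation is injective, so permuting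
  -- commuting operators yields an identity of polynomials.
  let K := FractionRing A
  let x : Fin n → K := fun i => algebraMap A K (MvPolynomial.X i)
  have hx : ∀ i, x i ≠ 0 := fun i =>
    (map_ne_zero_iff _ (IsFractionRing.injective A K)).2 (MvPolynomial.X_ne_zero i)
  have hq' : ∀ k : ℕ, 1 ≤ k → algebraMap F K q ^ k ≠ 1 := fun k hk h => by
    rw [← map_pow, ← map_one (algebraMap F K)] at h
    exact hq k hk ((algebraMap F K).injective h)
  have hinj : ∀ Q : A, MvPolynomial.aeval x Q = algebraMap A K Q := by
    intro Q
    have := MvPolynomial.comp_aeval_apply (R := F) MvPolynomial.X (IsScalarTower.toAlgHom F A K) Q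
    rw [MvPolynomial.aeval_X_left_apply] at this
    exact this.symm
  apply IsFractionRing.injective A K
  rw [← hinj, ← hinj, MvPolynomial.aeval_rename, ← hP K x hx, ← hP K (x ∘ σ) fun i => hx _]
  have hperm := σ.ofFn_comp_perm fun r => transfer (algebraMap F K q)
    (fun j => algebraMap F K (u j)) (fun j => algebraMap F K (v j)) (x r)
  have hcomm : (List.ofFn fun r => transfer (algebraMap F K q)
      (fun j => algebraMap F K (u j)) (fun j => algebraMap F K (v j)) (x (σ r))).Pairwise Commute :=
    List.pairwise_ofFn.2 fun i j _ => commute_transfer _ _ hq' (hx _) (hx _)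
  have := hperm.prod_eq' hcomm
  simp only [Function.comp_apply]
  exact congrArg (fun T : Module.End K (State →₀ K) =>
    T (Finsupp.single (columnState lam) 1) (columnState mu)) this

end

end FusedLattice

theorem mainTheorem8 {F : Type w} [Field F] (q : F) (hq : ∀ k : ℕ, 1 ≤ k → q ^ k ≠ 1)
    (u v : ℕ → F) (lam mu : YoungDiagram) (hmu : mu ≤ lam) (n : ℕ) :
    ∃ P : MvPolynomial (Fin n) F,
      (∀ (K : Type w) [Field K] [Algebra F K] (x : Fin n → K), (∀ i, x i ≠ 0) →
        FusedLattice.skewG (algebraMap F K q) (fun j => algebraMap F K (u j))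
          (fun j => algebraMap F K (v j)) lam mu x = MvPolynomial.aeval x P) ∧
      ∀ σ : Equiv.Perm (Fin n), MvPolynomial.rename σ P = P :=
  FusedLattice.exists_symmetric_poly_skewG q hq u v lam mu n
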